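/- Let $\Omega$ be a metrizable locally compact space, let $\Omega\cup\{\infty\}$ be its one-point compactification (if $\Omega$ is compact, $\infty$ is an isolated point), and let $C(\Omega)$ and $C_0(\Omega)$ be the algebras of all continuous functions on $\Omega$ and of those vanishing at infinity, with scalars $\mathbb R$ or $\mathbb C$. For a compact space $X$ let $X^{(1)}$ be the set of limit points of $X$, let $X^{(n+1)}$ be the set of limit points of $X^{(n)}$ for $n\ge 1$, and let $X^{(\infty)}=\bigcap_{n\ge 1}X^{(n)}$. For $f\in C(\Omega)$ put $\mathbf Z(f)=\{x\in\Omega: f(x)=0\}$, and let $\mathbf Z[\Omega]=\{\mathbf Z(f): f\in C(\Omega)\}$. A *$z$-filter* on $\Omega$ is a non-empty proper subset of $\mathbf Z[\Omega]$ closed under finite intersections and under supersets in $\mathbf Z[\Omega]$. A $z$-filter $\mathcal P$ is *prime* if $Z_1\cup Z_2\notin\mathcal P$ whenever $Z_1,Z_2\in\mathbf Z[\Omega]\setminus\mathcal P$. A prime $z$-filter $\mathcal P$ is *supported at* $x\in\Omega$ if $x\in Z$ for all $Z\in\mathcal P$, and *supported at $\infty$* if there is no such $x\in\Omega$. A *prime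 $z$-ideal* of $C_0(\Omega)$ is a proper ideal $P$ such that $fg\in P$ implies $f\in P$ or $g\in P$, and such that $g\in P$ whenever $g\in C_0(\Omega)$ and $\mathbf Z(g)\supseteq\mathbf Z(f)$ for some $f\in P$. It is *supported at* $x\in\Omega$ if $f(x)=0$ for all $f\in P$, and *supported at $\infty$* if there is no such $x\in\Omega$. Identify the cardinal $\mathfrak c=2^{\aleph_0}$ with the least ordinal of cardinality $\mathfrak c$. **Theorem.** Let $p\in(\Omega\cup\{\infty\})^{(\infty)}$. Then there is a family $(\mathcal Q_\alpha)_{\alpha<\mathfrak c}$ of prime $z$-filters on $\Omega$, each supported at $p$, such that $\mathcal Q_\beta\subsetneq\mathcal Q_\alpha$ whenever $\alpha<\beta<\mathfrak c$. Furthermore, the sets $Q_\alpha=\{f\in C_0(\Omega):\mathbf Z(f)\in\mathcal Q_\alpha\}$, $\alpha<\mathfrak c$, are prime $z$-ideals of $C_0(\Omega)$, each supported at $p$, and $Q_\beta\subsetneq Q_\alpha$ whenever $\alpha<\beta<\mathfrak c$. -/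

import Mathlib

open Set
open scoped OnePoint ZeroAtInfty

/-- The `n`-th level `X^(n)` of a space `X`: `X^(0) = X`, and `X^(n+1)` is the set of limit points
of `X^(n)`. The sets `X^(n)` are closed (when `X` is T₁), so it does not matter whether the limit
points of `X^(n)` are taken in `X` or in the subspace `X^(n)`. -/
def cbLevel (X : Type*) [TopologicalSpace X] : ℕ → Set X
  | 0 => univ
  | n + 1 => derivedSet (cbLevel X n)

/-- `X^(∞)`, the intersection of the levels `X^(n)`, `n ≥ 1`. -/
def cbLevelInfty (X : Type*) [TopologicalSpace X] : Set X :=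
  ⋂ n : ℕ, cbLevel X (n + 1)

section ZSets

variable (𝕜 : Type*) [RCLike 𝕜] {Ω : Type*} [TopologicalSpace Ω]

/-- The zero set `Z(f)` of a scalar-valued function. -/
def zeroSet {𝕜 : Type*} [RCLike 𝕜] {Ω : Type*} (f : Ω → 𝕜) : Set Ω :=
  {x | f x = 0}

variable (Ω) in
/-- `Z[Ω]`, the collection of all zero sets of continuous functions on `Ω`. -/
def zeroSets : Set (Set Ω) :=
  {Z | ∃ f : C(Ω, 𝕜), Z = zeroSet f}

/-- A `z`-filter: a non-empty proper subset of `Z[Ω]` that is closed under finite intersections and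
under supersets in `Z[Ω]`. -/
structure IsZFilter (F : Set (Set Ω)) : Prop where
  nonempty : F.Nonempty
  ssubset : F ⊂ zeroSets 𝕜 Ω
  inter_mem : ∀ Z₁ ∈ F, ∀ Z₂ ∈ F, Z₁ ∩ Z₂ ∈ F
  mem_of_superset : ∀ Z₁ ∈ F, ∀ Z₂ ∈ zeroSets 𝕜 Ω, Z₁ ⊆ Z₂ → Z₂ ∈ F

/-- A prime `z`-filter: the union of two zero sets outside of it is outside of it. -/
structure IsPrimeZFilter (F : Set (Set Ω)) : Prop extends IsZFilter 𝕜 F where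
  union_notMem : ∀ Z₁ ∈ zeroSets 𝕜 Ω \ F, ∀ Z₂ ∈ zeroSets 𝕜 Ω \ F, Z₁ ∪ Z₂ ∉ F

/-- `Z⁻¹[F]`, the set of continuous functions on `Ω` whose zero set belongs to `F`. -/
def zInv (F : Set (Set Ω)) : Set C(Ω, 𝕜) :=
  {f | zeroSet f ∈ F}

/-- `C₀(Ω) ∩ Z⁻¹[F]`, as a subset of `C₀(Ω)`. -/
def zInvC₀ (F : Set (Set Ω)) : Set C₀(Ω, 𝕜) :=
  {f | f.toContinuousMap ∈ zInv 𝕜 F}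

end ZSets

/-- Support of a prime `z`-filter: it is supported at the point `x` of `Ω` if `x` lies in all its
members, and at infinity if no point of `Ω` lies in all its members. -/
def ZFilterSupportedAt {Ω : Type*} (F : Set (Set Ω)) : OnePoint Ω → Prop
  | ∞ => ¬ ∃ x : Ω, ∀ Z ∈ F, x ∈ Z
  | OnePoint.some x => ∀ Z ∈ F, x ∈ Z

section Ideals

variable {𝕜 : Type*} [RCLike 𝕜] {Ω : Type*} [TopologicalSpace Ω]

/-- `I` is an ideal of the (commutative, possibly non-unital) algebra `C₀(Ω)`. -/
structure IsC₀Ideal (I : Set C₀(Ω, 𝕜)) : Prop where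
  zero_mem : 0 ∈ I
  add_mem : ∀ f ∈ I, ∀ g ∈ I, f + g ∈ I
  smul_mem : ∀ (c : 𝕜), ∀ f ∈ I, c • f ∈ I
  mul_mem : ∀ (g : C₀(Ω, 𝕜)), ∀ f ∈ I, g * f ∈ I

/-- A prime ideal of `C₀(Ω)`: a proper ideal `I` such that `f * g ∈ I` implies `f ∈ I` or
`g ∈ I`. -/
structure IsPrimeC₀Ideal (I : Set C₀(Ω, 𝕜)) : Prop extends IsC₀Ideal I where
  ne_univ : I ≠ univ
  mem_or_mem : ∀ f g : C₀(Ω, 𝕜), f * g ∈ I → f ∈ I ∨ g ∈ I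

/-- A prime `z`-ideal of `C₀(Ω)`: a prime ideal `I` such that `g ∈ I` whenever `Z(f) ⊆ Z(g)` for
some `f ∈ I`. -/
structure IsPrimeZIdeal (I : Set C₀(Ω, 𝕜)) : Prop extends IsPrimeC₀Ideal I where
  mem_of_zeroSet_subset : ∀ f ∈ I, ∀ g : C₀(Ω, 𝕜), zeroSet f ⊆ zeroSet g → g ∈ I

/-- Support of a prime ideal of `C₀(Ω)`: it is supported at the point `x` of `Ω` if all its members
vanish at `x`, and at infinity if its members have no common zero in `Ω`. -/
def IdealSupportedAt (P : Set C₀(Ω, 𝕜)) : OnePoint Ω → Prop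
  | ∞ => ¬ ∃ x : Ω, ∀ f ∈ P, f x = 0
  | OnePoint.some x => ∀ f ∈ P, f x = 0

end Ideals

/-! A point of level `n` carries `n + 1` nested prime `z`-filters (`exists_isPrimeZChain`): at a
limit of points of level `n`, an ultrafilter limit of their chains is again a chain, and the filter
of all closed sets through the limit point goes on top of it. Let points of level at least `n`, with
disjoint neighbourhoods `U n`, converge to `p`, and let `P n 0 ⊆ … ⊆ P n n` be the chain at the
`n`-th one. For `f ≤ id`, the limit of `P n (f n)` along a free ultrafilter is prime and supported
at `p`, and it shrinks strictly when `f` decreases strictly along the ultrafilter. So it suffices to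
find continuum many functions below the identity that decrease strictly along one ultrafilter
(`exists_ultrafilter_functions`). Disjointness of the `U n` lets separating sets be glued into the
zero set of one function in `C₀(Ω)`, so the same sets separate the filters and the ideals. -/

open Filter Topology

/-! ### Combinatorics on `ℕ`: a continuum-sized chain of functions modulo an ultrafilter. -/

section IndependentFunctions

/-- A linearly ordered family, of size at most the continuum, of functions `ℕ → ℕ` below the
identity, every finite subfamily of which is strictly decreasing at arbitrarily large places. -/
theorem exists_independent_functions {I : Type*} [LinearOrder I] (r : I → ℕ → Bool)
    (hr : Function.Injective r) :
    ∃ f : I → ℕ → ℕ, (∀ i n, f i n ≤ n) ∧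
      ∀ (s : Finset I) (N : ℕ), ∃ n ≥ N, ∀ α ∈ s, ∀ β ∈ s, α < β → f β n < f α n := by
  classical
  obtain ⟨e, he⟩ := exists_surjective_nat (Σ d : ℕ, (Fin d → Bool) → ℕ)
  -- Reading only the first unpaired coordinate makes every pair `(d, G)` occur at arbitrarily large
  -- `n`.
  let g : ℕ → Σ d : ℕ, (Fin d → Bool) → ℕ := fun n => e n.unpair.1
  refine ⟨fun i n => min n ((g n).2 fun k => r i k), fun i n => min_le_left _ _, fun s N => ?_⟩
  have hsep : ∀ α β : I, ∃ k, α ≠ β → r α k ≠ r β k := by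
    intro α β
    by_cases h : α = β
    · exact ⟨0, fun h' => (h' h).elim⟩
    · obtain ⟨k, hk⟩ := Function.ne_iff.1 (hr.ne h)
      exact ⟨k, fun _ => hk⟩
  choose k hk using hsep
  -- The first `d` bits of the codes already tell the members of `s` apart.
  let d := (s ×ˢ s).sup (fun q => k q.1 q.2) + 1
  let ρ : I → Fin d → Bool := fun i j => r i j
  have hinj : InjOn ρ s := by
    intro α hα β hβ h
    by_contra hne
    have hlt : k α β < d :=
      Nat.lt_succ_of_le (Finset.le_sup (f := fun q : I × I => k q.1 q.2)
        (Finset.mk_mem_product hα hβ))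
    exact hk α β hne (congrFun h ⟨k α β, hlt⟩)
  -- Counting the members of `s` above `α` gives a strictly decreasing function on `s`, bounded by
  -- `s.card`.
  let c : I → ℕ := fun α => (s.filter (α < ·)).card
  have hc : ∀ α, c α ≤ s.card := fun α => Finset.card_filter_le _ _
  obtain ⟨G, hG⟩ : ∃ G : (Fin d → Bool) → ℕ, ∀ α ∈ s, G (ρ α) = c α := by
    rcases isEmpty_or_nonempty I with hI | hI
    · exact ⟨fun _ => 0, fun α => hI.elim α⟩
    · exact ⟨fun t => c (Function.invFunOn ρ s t), fun α hα =>
        congrArg c (hinj.leftInvOn_invFunOn hα)⟩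
  obtain ⟨a, ha⟩ := he ⟨d, G⟩
  -- The second coordinate makes the place at least `N`, and at least `s.card` so that the
  -- truncation by `min` has no effect on `s`.
  have hn : max N s.card ≤ Nat.pair a (max N s.card) := Nat.right_le_pair _ _
  refine ⟨Nat.pair a (max N s.card), (le_max_left _ _).trans hn, fun α hα β hβ hlt => ?_⟩
  have hval : ∀ γ ∈ s, min (Nat.pair a (max N s.card))
      ((g (Nat.pair a (max N s.card))).2 fun k => r γ k) = c γ := by
    intro γ hγ
    have h1 : g (Nat.pair a (max N s.card)) = ⟨d, G⟩ := by simp [g, ha]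
    rw [h1]
    change min _ (G (ρ γ)) = _
    rw [hG γ hγ]
    exact min_eq_right ((hc γ).trans ((le_max_right _ _).trans hn))
  change min _ _ < min _ _
  rw [hval α hα, hval β hβ]
  refine Finset.card_lt_card (Finset.ssubset_iff_of_subset ?_ |>.2 ⟨β, ?_, ?_⟩)
  · intro γ hγ
    simp only [Finset.mem_filter] at hγ ⊢
    exact ⟨hγ.1, hlt.trans hγ.2⟩
  · simp [hβ, hlt]
  · simp

/-- Along a suitable free ultrafilter, a family as in `exists_independent_functions` is
strictly decreasing. -/
theorem exists_ultrafilter_functions {I : Type*} [LinearOrder I] (r : I → ℕ → Bool)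
    (hr : Function.Injective r) :
    ∃ (f : I → ℕ → ℕ) (𝒱 : Ultrafilter ℕ), (∀ i n, f i n ≤ n) ∧ (𝒱 : Filter ℕ) ≤ atTop ∧
      ∀ α β, α < β → ∀ᶠ n in (𝒱 : Filter ℕ), f β n < f α n := by
  classical
  obtain ⟨f, hf, hs⟩ := exists_independent_functions r hr
  choose n hnN hn using hs
  -- Larger finite sets impose more inequalities, so each single inequality holds eventually along
  -- `F`, hence along any finer ultrafilter.
  let F : Filter ℕ := map (fun q : Finset I × ℕ => n q.1 q.2) atTop
  refine ⟨f, Ultrafilter.of F, hf, (Ultrafilter.of_le F).trans ?_, fun α β hαβ => ?_⟩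
  · exact tendsto_atTop_mono (fun q : Finset I × ℕ => hnN q.1 q.2)
      (by rw [← prod_atTop_atTop_eq]; exact tendsto_snd)
  · refine Ultrafilter.of_le F ?_
    refine mem_map.2 (mem_of_superset (mem_atTop ({α, β}, 0)) ?_)
    rintro ⟨s, N⟩ hsN
    have h : ({α, β} : Finset I) ⊆ s := hsN.1
    exact hn s N α (h (by simp)) β (h (by simp)) hαβ

end IndependentFunctions

/-! ### Zero sets in metrizable spaces. -/

section ZeroSets

variable {𝕜 : Type*} [RCLike 𝕜] {Ω : Type*} [TopologicalSpace Ω]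

theorem isClosed_of_mem_zeroSets {Z : Set Ω} (hZ : Z ∈ zeroSets 𝕜 Ω) : IsClosed Z := by
  obtain ⟨f, rfl⟩ := hZ
  exact isClosed_eq f.continuous continuous_const

theorem exists_zeroSet_eq_of_isClosed [TopologicalSpace.MetrizableSpace Ω] {B : Set Ω}
    (hB : IsClosed B) :
    ∃ g : C(Ω, ℝ), (∀ x, 0 ≤ g x) ∧ (∀ x, g x ≤ 1) ∧ ∀ x, g x = 0 ↔ x ∈ B := by
  let := TopologicalSpace.metrizableSpaceMetric Ω
  rcases B.eq_empty_or_nonempty with rfl | hne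
  · exact ⟨1, by simp, by simp, by simp⟩
  · refine ⟨⟨fun x => min (Metric.infDist x B) 1, by fun_prop⟩, fun x => ?_, fun x => ?_,
      fun x => ?_⟩
    · exact le_min Metric.infDist_nonneg zero_le_one
    · exact min_le_right _ _
    · rw [hB.mem_iff_infDist_zero hne]
      change min (Metric.infDist x B) 1 = 0 ↔ _
      constructor
      · intro h
        rcases min_choice (Metric.infDist x B) 1 with h' | h' <;> rw [h'] at h
        · exact h
        · norm_num at h
      · intro h
        simp [h]

theorem mem_zeroSets_iff [TopologicalSpace.MetrizableSpace Ω] {Z : Set Ω} :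
    Z ∈ zeroSets 𝕜 Ω ↔ IsClosed Z := by
  refine ⟨isClosed_of_mem_zeroSets, fun hZ => ?_⟩
  obtain ⟨g, -, -, hg⟩ := exists_zeroSet_eq_of_isClosed hZ
  exact ⟨⟨fun x => (g x : 𝕜), by fun_prop⟩, by ext x; simp [zeroSet, hg]⟩

/-- Given relatively compact open sets `U n` and closed sets `C n`, the set
`⋂ n, C n ∪ (U n)ᶜ` is the zero set of a function vanishing at infinity. -/
theorem exists_zeroSet_zeroAtInfty [TopologicalSpace.MetrizableSpace Ω]
    (U C : ℕ → Set Ω) (hU : ∀ n, IsOpen (U n)) (hUc : ∀ n, ∃ K, IsCompact K ∧ U n ⊆ K)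
    (hC : ∀ n, IsClosed (C n)) :
    ∃ h : C₀(Ω, 𝕜), zeroSet h = ⋂ n, (C n ∪ (U n)ᶜ) := by
  choose K hK hUK using hUc
  choose g hg0 hg1 hg using fun n =>
    exists_zeroSet_eq_of_isClosed ((hC n).union (hU n).isClosed_compl)
  -- Each term vanishes off a compact set, so the dominated sum vanishes at infinity; as the terms
  -- are nonnegative, its zeros are the common zeros.
  let F : ℕ → Ω → ℝ := fun n x => (1 / 2) ^ n * g n x
  have hs : Summable fun n : ℕ => (1 / 2 : ℝ) ^ n := summable_geometric_two
  have hF0 : ∀ n x, 0 ≤ F n x := fun n x => mul_nonneg (by positivity) (hg0 n x)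
  have hF1 : ∀ n x, ‖F n x‖ ≤ (1 / 2) ^ n := fun n x => by
    rw [Real.norm_of_nonneg (hF0 n x)]
    exact mul_le_of_le_one_right (by positivity) (hg1 n x)
  have hsum : ∀ x, Summable fun n => F n x := fun x =>
    Summable.of_norm_bounded hs fun n => hF1 n x
  have hcont : Continuous fun x => ∑' n, F n x :=
    continuous_tsum (fun n => by fun_prop) hs hF1
  have hlim : Tendsto (fun x => ∑' n, F n x) (cocompact Ω) (𝓝 0) := by
    have := tendsto_tsum_of_dominated_convergence (𝓕 := cocompact Ω) (f := fun x n => F n x)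
      (g := fun _ => (0 : ℝ)) hs (fun n => ?_) (Eventually.of_forall fun x n => hF1 n x)
    · simpa using this
    · refine tendsto_const_nhds.congr' ?_
      filter_upwards [(hK n).compl_mem_cocompact] with x hx
      have : g n x = 0 := (hg n x).2 (Or.inr fun h => hx (hUK n h))
      simp [F, this]
  have hzero : ∀ x, ∑' n, F n x = 0 ↔ ∀ n, x ∈ C n ∪ (U n)ᶜ := by
    intro x
    rw [← (hsum x).hasSum_iff, hasSum_zero_iff_of_nonneg (fun n => hF0 n x), funext_iff]
    exact forall_congr' fun n => by rw [← hg]; simp [F]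
  refine ⟨⟨⟨fun x => ((∑' n, F n x : ℝ) : 𝕜), by fun_prop⟩, ?_⟩, ?_⟩
  · have := (RCLike.continuous_ofReal (K := 𝕜)).tendsto 0 |>.comp hlim
    simpa [Function.comp_def] using this
  · ext x
    change ((∑' n, F n x : ℝ) : 𝕜) = 0 ↔ _
    rw [RCLike.ofReal_eq_zero, hzero, mem_iInter]

end ZeroSets

/-! ### Prime `z`-filters and their ultrafilter limits. -/

section ZFilters

variable {𝕜 : Type*} [RCLike 𝕜] {Ω : Type*} [TopologicalSpace Ω] {F : Set (Set Ω)}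

theorem univ_mem_zeroSets : univ ∈ zeroSets 𝕜 Ω :=
  ⟨0, by ext; simp [zeroSet]⟩

theorem empty_mem_zeroSets : ∅ ∈ zeroSets 𝕜 Ω :=
  ⟨1, by ext; simp [zeroSet]⟩

theorem IsZFilter.univ_mem (hF : IsZFilter 𝕜 F) : univ ∈ F := by
  obtain ⟨Z, hZ⟩ := hF.nonempty
  exact hF.mem_of_superset Z hZ _ univ_mem_zeroSets (subset_univ _)

theorem IsZFilter.empty_notMem (hF : IsZFilter 𝕜 F) : ∅ ∉ F := fun h =>
  hF.ssubset.2 fun Z hZ => hF.mem_of_superset ∅ h Z hZ (empty_subset _)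

theorem IsZFilter.isClosed (hF : IsZFilter 𝕜 F) {Z : Set Ω} (hZ : Z ∈ F) : IsClosed Z :=
  isClosed_of_mem_zeroSets (hF.ssubset.1 hZ)

theorem IsZFilter.mem_of_subset [TopologicalSpace.MetrizableSpace Ω] (hF : IsZFilter 𝕜 F)
    {Z₁ Z₂ : Set Ω} (h₁ : Z₁ ∈ F) (h₂ : IsClosed Z₂) (h : Z₁ ⊆ Z₂) : Z₂ ∈ F :=
  hF.mem_of_superset Z₁ h₁ Z₂ (mem_zeroSets_iff.2 h₂) h

theorem IsPrimeZFilter.mem_or_mem [TopologicalSpace.MetrizableSpace Ω] (hF : IsPrimeZFilter 𝕜 F)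
    {Z₁ Z₂ : Set Ω} (h₁ : IsClosed Z₁) (h₂ : IsClosed Z₂) (h : Z₁ ∪ Z₂ ∈ F) :
    Z₁ ∈ F ∨ Z₂ ∈ F := by
  by_contra! h'
  exact hF.union_notMem Z₁ ⟨mem_zeroSets_iff.2 h₁, h'.1⟩ Z₂ ⟨mem_zeroSets_iff.2 h₂, h'.2⟩ h

/-- The limit of a sequence of families of sets along an ultrafilter. -/
def ultraLimit (𝒱 : Ultrafilter ℕ) (P : ℕ → Set (Set Ω)) : Set (Set Ω) :=
  {Z | ∀ᶠ n in (𝒱 : Filter ℕ), Z ∈ P n}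

theorem isPrimeZFilter_ultraLimit (𝒱 : Ultrafilter ℕ) {P : ℕ → Set (Set Ω)}
    (hP : ∀ n, IsPrimeZFilter 𝕜 (P n)) : IsPrimeZFilter 𝕜 (ultraLimit 𝒱 P) where
  nonempty := ⟨univ, Eventually.of_forall fun n => (hP n).univ_mem⟩
  ssubset := by
    refine ⟨fun Z (hZ : ∀ᶠ n in (𝒱 : Filter ℕ), Z ∈ P n) => ?_, fun h => ?_⟩
    · obtain ⟨n, hn⟩ := hZ.exists
      exact (hP n).ssubset.1 hn
    · obtain ⟨n, hn⟩ := Eventually.exists (h (empty_mem_zeroSets (𝕜 := 𝕜)))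
      exact (hP n).empty_notMem hn
  inter_mem Z₁ h₁ Z₂ h₂ := by
    filter_upwards [h₁, h₂] with n h₁ h₂ using (hP n).inter_mem Z₁ h₁ Z₂ h₂
  mem_of_superset Z₁ h₁ Z₂ h₂ h := by
    filter_upwards [h₁] with n h₁ using (hP n).mem_of_superset Z₁ h₁ Z₂ h₂ h
  union_notMem Z₁ h₁ Z₂ h₂ h := by
    have h₁' := Ultrafilter.eventually_not.2 h₁.2
    have h₂' := Ultrafilter.eventually_not.2 h₂.2
    obtain ⟨n, hn, hn₁, hn₂⟩ := (Eventually.and h (h₁'.and h₂')).exists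
    exact (hP n).union_notMem Z₁ ⟨h₁.1, hn₁⟩ Z₂ ⟨h₂.1, hn₂⟩ hn

theorem isPrimeZFilter_point [TopologicalSpace.MetrizableSpace Ω] (x : Ω) :
    IsPrimeZFilter 𝕜 {Z : Set Ω | IsClosed Z ∧ x ∈ Z} where
  nonempty := ⟨univ, isClosed_univ, mem_univ x⟩
  ssubset := ⟨fun Z hZ => mem_zeroSets_iff.2 hZ.1, fun h => (h empty_mem_zeroSets).2⟩
  inter_mem Z₁ h₁ Z₂ h₂ := ⟨h₁.1.inter h₂.1, h₁.2, h₂.2⟩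
  mem_of_superset Z₁ h₁ Z₂ h₂ h := ⟨isClosed_of_mem_zeroSets h₂, h h₁.2⟩
  union_notMem Z₁ h₁ Z₂ h₂ h := by
    rcases h.2 with h | h
    · exact h₁.2 ⟨isClosed_of_mem_zeroSets h₁.1, h⟩
    · exact h₂.2 ⟨isClosed_of_mem_zeroSets h₂.1, h⟩

/-- A prime `z`-filter supported at `x` contains all closed neighbourhoods of `x`. -/
theorem IsPrimeZFilter.mem_of_mem_nhds [TopologicalSpace.MetrizableSpace Ω]
    (hF : IsPrimeZFilter 𝕜 F) {x : Ω} (hx : ∀ Z ∈ F, x ∈ Z) {W : Set Ω} (hW : IsClosed W)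
    (hxW : W ∈ 𝓝 x) : W ∈ F := by
  have h : W ∪ (interior W)ᶜ = univ :=
    eq_univ_of_subset (union_subset_union_left _ interior_subset) (union_compl_self _)
  refine (hF.mem_or_mem hW isOpen_interior.isClosed_compl (h ▸ hF.univ_mem)).resolve_right ?_
  exact fun h' => hx _ h' (mem_interior_iff_mem_nhds.2 hxW)

/-- Membership depends only on the germ at `x`: a closed neighbourhood of `x` inside `U k` belongs
to `F`, and on it the intersection agrees with `C k` because it misses every other `U n`. -/
theorem IsPrimeZFilter.iInter_union_compl_mem_iff [TopologicalSpace.MetrizableSpace Ω]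
    (hF : IsPrimeZFilter 𝕜 F) {x : Ω} (hx : ∀ Z ∈ F, x ∈ Z) {U C : ℕ → Set Ω}
    (hU : ∀ n, IsOpen (U n)) (hd : Pairwise (Function.onFun Disjoint U))
    (hC : ∀ n, IsClosed (C n)) {k : ℕ} (hk : x ∈ U k) :
    (⋂ n, (C n ∪ (U n)ᶜ)) ∈ F ↔ C k ∈ F := by
  obtain ⟨W, hW, hWc, hWU⟩ := exists_mem_nhds_isClosed_subset ((hU k).mem_nhds hk)
  have hWF := hF.mem_of_mem_nhds hx hWc hW
  constructor <;> intro h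
  · refine hF.mem_of_subset (hF.inter_mem _ h _ hWF) (hC k) fun y hy => ?_
    exact (mem_iInter.1 hy.1 k).resolve_right fun h' => h' (hWU hy.2)
  · refine hF.mem_of_subset (hF.inter_mem _ h _ hWF)
      (isClosed_iInter fun n => (hC n).union (hU n).isClosed_compl) fun y hy => ?_
    refine mem_iInter.2 fun n => ?_
    rcases eq_or_ne n k with rfl | hn
    · exact Or.inl hy.1
    · exact Or.inr (disjoint_right.1 (hd hn) (hWU hy.2))

end ZFilters

/-! ### Sequences converging to `p` through the levels. -/

section Sequences

variable {Ω : Type*} [TopologicalSpace Ω]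

/-- Greedy choice: finitely many compact neighbourhoods that avoid `p` have closed union in the
compactification, so the sequence eventually leaves them and a new compact neighbourhood fits
outside. -/
theorem exists_subseq_disjoint_nhds [T2Space Ω] [LocallyCompactSpace Ω] {p : OnePoint Ω}
    {u : ℕ → Ω} (hu : Tendsto (fun n => (u n : OnePoint Ω)) atTop (𝓝 p))
    (hne : ∀ n, (u n : OnePoint Ω) ≠ p) :
    ∃ (φ : ℕ → ℕ) (U : ℕ → Set Ω), StrictMono φ ∧ (∀ n, IsOpen (U n)) ∧
      (∀ n, ∃ K, IsCompact K ∧ U n ⊆ K) ∧ Pairwise (Function.onFun Disjoint U) ∧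
      ∀ n, u (φ n) ∈ U n := by
  classical
  let R : ℕ × Set Ω → Prop := fun q =>
    IsCompact q.2 ∧ q.2 ∈ 𝓝 (u q.1) ∧ p ∉ ((↑) : Ω → OnePoint Ω) '' q.2
  have hstep : ∀ s : Finset (ℕ × Set Ω), (∀ q ∈ s, R q) →
      ∃ q', R q' ∧ ∀ q ∈ s, q.1 < q'.1 ∧ Disjoint q.2 q'.2 := by
    intro s hs
    have hcl : ∀ q ∈ s, IsClosed (((↑) : Ω → OnePoint Ω) '' q.2) := fun q hq =>
      ((hs q hq).1.image OnePoint.continuous_coe).isClosed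
    have hev : ∀ᶠ n in atTop, ∀ q ∈ s, (u n : OnePoint Ω) ∉ ((↑) : Ω → OnePoint Ω) '' q.2 :=
      (eventually_all_finset s).2 fun q hq =>
        hu.eventually ((hcl q hq).isOpen_compl.mem_nhds (hs q hq).2.2)
    obtain ⟨n, hn, hns⟩ := (hev.and (eventually_gt_atTop (s.sup Prod.fst))).exists
    let O : Set (OnePoint Ω) := {p}ᶜ ∩ ⋂ q ∈ s, (((↑) : Ω → OnePoint Ω) '' q.2)ᶜ
    have hO : IsOpen O := isOpen_compl_singleton.inter
      (isOpen_biInter_finset fun q hq => (hcl q hq).isOpen_compl)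
    have hnO : (u n : OnePoint Ω) ∈ O := ⟨hne n, mem_iInter₂.2 hn⟩
    obtain ⟨K, hK, hKO, hKc⟩ := local_compact_nhds
      ((hO.preimage OnePoint.continuous_coe).mem_nhds hnO)
    refine ⟨(n, K), ⟨hKc, hK, ?_⟩, fun q hq => ⟨(Finset.le_sup hq).trans_lt hns, ?_⟩⟩
    · rintro ⟨y, hy, rfl⟩
      exact (hKO hy).1 rfl
    · exact disjoint_right.2 fun y hy hyq => mem_iInter₂.1 (hKO hy).2 q hq ⟨y, hyq, rfl⟩
  obtain ⟨f, hf, hf'⟩ := exists_seq_of_forall_finset_exists R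
    (fun q q' => q.1 < q'.1 ∧ Disjoint q.2 q'.2) hstep
  refine ⟨fun n => (f n).1, fun n => interior (f n).2,
    strictMono_nat_of_lt_succ fun n => (hf' n (n + 1) n.lt_succ_self).1,
    fun n => isOpen_interior, fun n => ⟨(f n).2, (hf n).1, interior_subset⟩, ?_,
    fun n => mem_interior_iff_mem_nhds.2 (hf n).2.1⟩
  have : ∀ m n, m < n → Disjoint (interior (f m).2) (interior (f n).2) := fun m n h =>
    (hf' m n h).2.mono interior_subset interior_subset
  intro m n hmn
  rcases lt_or_gt_of_ne hmn with h | h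
  · exact this m n h
  · exact (this n m h).symm

theorem isClosed_cbLevel (X : Type*) [TopologicalSpace X] [T1Space X] :
    ∀ n, IsClosed (cbLevel X n)
  | 0 => isClosed_univ
  | _ + 1 => isClosed_derivedSet _

theorem antitone_cbLevel (X : Type*) [TopologicalSpace X] [T1Space X] : Antitone (cbLevel X) :=
  antitone_nat_of_succ_le fun n =>
    (isClosed_iff_derivedSet_subset _).1 (isClosed_cbLevel X n)

/-- A sequence in a decreasing sequence of closed sets that tends to a point at which all of them
accumulate. -/
theorem exists_seq_tendsto_of_accPt [TopologicalSpace.MetrizableSpace Ω] [LocallyCompactSpace Ω]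
    {p : OnePoint Ω} {Y : ℕ → Set (OnePoint Ω)} (hY : ∀ n, IsClosed (Y n)) (hanti : Antitone Y)
    (hp : ∀ n, AccPt p (𝓟 (Y n))) :
    ∃ u : ℕ → Ω, (∀ n, (u n : OnePoint Ω) ∈ Y n) ∧ (∀ n, (u n : OnePoint Ω) ≠ p) ∧
      Tendsto (fun n => (u n : OnePoint Ω)) atTop (𝓝 p) := by
  have hfr : ∀ n, ∃ᶠ y in 𝓝[≠] p, y ∈ Y n := fun n => accPt_iff_frequently_nhdsNE.1 (hp n)
  induction p using OnePoint.rec with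
  | coe x =>
    have hne : ((↑) : Ω → OnePoint Ω) ⁻¹' {(x : OnePoint Ω)}ᶜ = {x}ᶜ := by ext; simp
    simp only [OnePoint.nhdsWithin_coe, hne, frequently_map] at hfr
    obtain ⟨B, hB⟩ := (𝓝[≠] x).exists_antitone_basis
    have hex : ∀ n, ∃ y : Ω, y ∈ B n ∩ {x}ᶜ ∧ (y : OnePoint Ω) ∈ Y n := fun n =>
      let ⟨y, hy, hy'⟩ := ((hfr n).and_eventually
        (inter_mem (hB.mem n) self_mem_nhdsWithin)).exists
      ⟨y, hy', hy⟩
    choose u hu huY using hex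
    refine ⟨u, huY, fun n h => (hu n).2 (OnePoint.coe_injective h), ?_⟩
    refine (OnePoint.continuous_coe.tendsto x).comp ?_
    exact (hB.tendsto fun n => (hu n).1).mono_right nhdsWithin_le_nhds
  -- When `Ω` is not σ-compact, `∞` has no countable neighbourhood basis, so the sequence needs
  -- another source.
  | infty =>
    simp only [OnePoint.nhdsNE_infty_eq, frequently_map, coclosedCompact_eq_cocompact] at hfr
    let T : ℕ → Set Ω := fun n => (↑) ⁻¹' Y n
    have hT : ∀ n, IsClosed (T n) := fun n => (hY n).preimage OnePoint.continuous_coe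
    have hout : ∀ n (K : Set Ω), IsCompact K → ∃ y ∈ T n, y ∉ K := fun n K hK =>
      ((hfr n).and_eventually hK.compl_mem_cocompact).exists
    have key : ∃ u : ℕ → Ω, (∀ n, u n ∈ T n) ∧ Tendsto u atTop (cocompact Ω) := by
      -- If the intersection lies in a compact `K`, points of `T n` outside a compact neighbourhood
      -- `W` of `K` work: by compactness some `T N` misses `C \ interior W`. Otherwise the
      -- intersection is not compact and contains a sequence with no subsequence converging in it;
      -- such a sequence leaves every compact set.
      by_cases hcomp : ∃ K, IsCompact K ∧ ⋂ n, T n ⊆ K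
      · obtain ⟨K, hK, hTK⟩ := hcomp
        obtain ⟨W, hW, hKW⟩ := exists_compact_superset hK
        choose u hu huW using fun n => hout n W hW
        refine ⟨u, hu, (hasBasis_cocompact.tendsto_right_iff).2 fun C hC => ?_⟩
        have hemp : (C \ interior W) ∩ ⋂ n, T n = ∅ := by
          ext y
          simp only [mem_inter_iff, Set.mem_sdiff, mem_empty_iff_false, iff_false]
          exact fun h => h.1.2 (hKW (hTK h.2))
        obtain ⟨N, hN⟩ := (hC.diff isOpen_interior).elim_directed_family_closed
          T hT hemp (directed_of_isDirected_le fun m n h => preimage_mono (hanti h))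
        filter_upwards [eventually_ge_atTop N] with n hn hnC
        have : u n ∈ (C \ interior W) ∩ T N :=
          ⟨⟨hnC, fun h => huW n (interior_subset h)⟩, hanti hn (hu n)⟩
        rw [hN] at this
        exact this
      · have hnc : ¬ IsCompact (⋂ n, T n) := fun h => hcomp ⟨_, h, Subset.rfl⟩
        let := TopologicalSpace.metrizableSpaceMetric Ω
        rw [isCompact_iff_isSeqCompact, IsSeqCompact] at hnc
        push Not at hnc
        obtain ⟨u, hu, hun⟩ := hnc
        refine ⟨u, fun n => mem_iInter.1 (hu n) n,
          (hasBasis_cocompact.tendsto_right_iff).2 fun C hC => ?_⟩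
        by_contra hC'
        have hfrC : ∃ᶠ n in atTop, u n ∈ C := by
          simpa [Filter.Frequently] using hC'
        obtain ⟨a, -, φ, hφ, ha⟩ := hC.tendsto_subseq' hfrC
        refine hun a ?_ φ hφ ha
        exact (isClosed_iInter hT).mem_of_tendsto ha (Eventually.of_forall fun n => hu _)
    obtain ⟨u, hu, hlim⟩ := key
    refine ⟨u, hu, fun n => OnePoint.coe_ne_infty _, ?_⟩
    rw [← coclosedCompact_eq_cocompact] at hlim
    exact OnePoint.tendsto_coe_infty.comp hlim

end Sequences

/-! ### Finite chains at points of finite level, and long chains at `p`. -/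

section Chains

variable (𝕜 : Type*) [RCLike 𝕜] {Ω : Type*} [TopologicalSpace Ω]

/-- An increasing sequence `P` of prime `z`-filters supported at `x`, whose terms `P 0, …, P m` are
told apart by the closed sets `D 0, …, D m`. -/
structure IsPrimeZChain (x : Ω) (m : ℕ) (P : ℕ → Set (Set Ω)) (D : ℕ → Set Ω) : Prop where
  isPrime : ∀ j, IsPrimeZFilter 𝕜 (P j)
  mono : Monotone P
  mem_of_mem : ∀ j, ∀ Z ∈ P j, x ∈ Z
  isClosed : ∀ i, IsClosed (D i)
  mem_iff : ∀ i ≤ m, ∀ j ≤ m, D i ∈ P j ↔ i ≤ j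

variable [TopologicalSpace.MetrizableSpace Ω] [LocallyCompactSpace Ω]

theorem exists_isPrimeZChain (m : ℕ) (x : Ω) (hx : (x : OnePoint Ω) ∈ cbLevel (OnePoint Ω) m) :
    ∃ P D, IsPrimeZChain 𝕜 x m P D := by
  induction m generalizing x with
  | zero =>
    refine ⟨fun _ => {Z | IsClosed Z ∧ x ∈ Z}, fun _ => univ, fun _ => isPrimeZFilter_point x,
      fun _ _ _ => le_rfl, fun _ Z hZ => hZ.2, fun _ => isClosed_univ, fun i hi j hj => ?_⟩
    simp [Nat.le_zero.1 hi]
  | succ m ih =>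
    obtain ⟨v, hv, hvne, hvlim⟩ := exists_seq_tendsto_of_accPt
      (Y := fun _ => cbLevel (OnePoint Ω) m) (fun _ => isClosed_cbLevel _ m)
      (fun _ _ _ => le_rfl) (fun _ => hx)
    obtain ⟨φ, U, hφ, hU, hUc, hd, hmem⟩ := exists_subseq_disjoint_nhds hvlim hvne
    choose P D hPD using fun k => ih (v (φ k)) (hv (φ k))
    have hlim : Tendsto (fun k => v (φ k)) (hyperfilter ℕ) (𝓝 x) := by
      have h1 : Tendsto v atTop (𝓝 x) := by
        rw [← OnePoint.comap_coe_nhds, tendsto_comap_iff]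
        exact hvlim
      exact (h1.comp hφ.tendsto_atTop).mono_left Nat.hyperfilter_le_atTop
    let Q : ℕ → Set (Set Ω) := fun j => ultraLimit (hyperfilter ℕ) fun k => P k j
    have hQ : ∀ j, IsPrimeZFilter 𝕜 (Q j) := fun j =>
      isPrimeZFilter_ultraLimit _ fun k => (hPD k).isPrime j
    have hQx : ∀ j, ∀ Z ∈ Q j, IsClosed Z ∧ x ∈ Z := fun j Z hZ => by
      have hcl := (hQ j).isClosed hZ
      refine ⟨hcl, hcl.mem_of_tendsto hlim ?_⟩
      exact Eventually.mono hZ fun k hk => (hPD k).mem_of_mem j Z hk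
    let E : ℕ → Set Ω := fun i => ⋂ k, (D k i ∪ (U k)ᶜ)
    have hE : ∀ i, IsClosed (E i) := fun i =>
      isClosed_iInter fun k => ((hPD k).isClosed i).union (hU k).isClosed_compl
    have hEQ : ∀ i ≤ m, ∀ j ≤ m, E i ∈ Q j ↔ i ≤ j := fun i hi j hj => by
      have : ∀ k, E i ∈ P k j ↔ i ≤ j := fun k =>
        (((hPD k).isPrime j).iInter_union_compl_mem_iff ((hPD k).mem_of_mem j) hU hd
          (fun k => (hPD k).isClosed i) (hmem k)).trans ((hPD k).mem_iff i hi j hj)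
      simp [Q, ultraLimit, this]
    -- The new top filter at index `m + 1` consists of all closed sets through `x`. It is separated
    -- by `{x}`, which lies in no `Q j` since the approximating points differ from `x`.
    refine ⟨fun j => if j ≤ m then Q j else {Z | IsClosed Z ∧ x ∈ Z},
      fun i => if i ≤ m then E i else {x}, fun j => ?_, fun j j' hjj' => ?_, fun j Z hZ => ?_,
      fun i => ?_, fun i hi j hj => ?_⟩
    · split_ifs
      exacts [hQ j, isPrimeZFilter_point x]
    · split_ifs with h h' h'
      · exact fun Z hZ => Eventually.mono hZ fun k hk => (hPD k).mono hjj' hk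
      · exact hQx j
      · exact absurd (hjj'.trans h') h
      · exact le_rfl
    · split_ifs at hZ
      exacts [(hQx j Z hZ).2, hZ.2]
    · split_ifs
      exacts [hE i, isClosed_singleton]
    · split_ifs with h h' h'
      · exact hEQ i h' j h
      · refine iff_of_false (fun hZ => ?_) (by omega)
        obtain ⟨k, hk⟩ := Eventually.exists (f := (hyperfilter ℕ : Filter ℕ)) hZ
        exact hvne (φ k) (congrArg _ ((hPD k).mem_of_mem j _ hk))
      · exact iff_of_true (hQx m _ ((hEQ i h' m le_rfl).2 h')) (by omega)
      · exact iff_of_true ⟨isClosed_singleton, rfl⟩ (by omega)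

/-- Prime `z`-filters at a point of infinite Cantor–Bendixson rank, indexed by any
linear order of size at most the continuum. -/
theorem exists_chain_of_mem_cbLevelInfty {I : Type*} [LinearOrder I] (r : I → ℕ → Bool)
    (hr : Function.Injective r) {p : OnePoint Ω} (hp : p ∈ cbLevelInfty (OnePoint Ω)) :
    ∃ 𝒬 : I → Set (Set Ω), Antitone 𝒬 ∧ (∀ α, IsPrimeZFilter 𝕜 (𝒬 α)) ∧
      (∀ α β, α < β → ∃ h : C₀(Ω, 𝕜), zeroSet h ∈ 𝒬 α ∧ zeroSet h ∉ 𝒬 β) ∧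
      (∃ h : C₀(Ω, 𝕜), ∀ α, zeroSet h ∉ 𝒬 α) ∧
      ∃ (u : ℕ → Ω) (𝒱 : Ultrafilter ℕ),
        Tendsto (fun n => (u n : OnePoint Ω)) 𝒱 (𝓝 p) ∧
        ∀ α, ∀ Z ∈ 𝒬 α, ∀ᶠ n in (𝒱 : Filter ℕ), u n ∈ Z := by
  obtain ⟨v, hv, hvne, hvlim⟩ := exists_seq_tendsto_of_accPt (isClosed_cbLevel (OnePoint Ω))
    (antitone_cbLevel _) (fun n => mem_iInter.1 hp n)
  obtain ⟨φ, U, hφ, hU, hUc, hd, hmem⟩ := exists_subseq_disjoint_nhds hvlim hvne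
  choose P D hPD using fun n => exists_isPrimeZChain 𝕜 n (v (φ n))
    (antitone_cbLevel _ (hφ.id_le n) (hv (φ n)))
  obtain ⟨f, 𝒱, hf, h𝒱, hlt⟩ := exists_ultrafilter_functions r hr
  let 𝒬 : I → Set (Set Ω) := fun α => ultraLimit 𝒱 fun n => P n (f α n)
  have hclosed : ∀ C : ℕ → Set Ω, (∀ n, IsClosed (C n)) → ∀ α,
      (⋂ n, (C n ∪ (U n)ᶜ)) ∈ 𝒬 α ↔ ∀ᶠ n in (𝒱 : Filter ℕ), C n ∈ P n (f α n) :=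
    fun C hC α => eventually_congr (Eventually.of_forall fun n =>
      ((hPD n).isPrime _).iInter_union_compl_mem_iff ((hPD n).mem_of_mem _) hU hd hC (hmem n))
  refine ⟨𝒬, fun α β hαβ => ?_, fun α => isPrimeZFilter_ultraLimit _ fun n => (hPD n).isPrime _,
    fun α β hαβ => ?_, ?_, fun n => v (φ n), 𝒱, ?_, fun α Z hZ => ?_⟩
  · rcases hαβ.eq_or_lt with rfl | h
    · exact le_rfl
    · intro Z hZ
      filter_upwards [hlt α β h, hZ] with n hn hZn using (hPD n).mono hn.le hZn
  · have hC : ∀ n, IsClosed (D n (f α n)) := fun n => (hPD n).isClosed _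
    obtain ⟨h, hh⟩ := exists_zeroSet_zeroAtInfty (𝕜 := 𝕜) U _ hU hUc hC
    refine ⟨h, ?_, ?_⟩ <;> rw [hh, hclosed _ hC]
    · exact Eventually.of_forall fun n =>
        ((hPD n).mem_iff _ (hf α n) _ (hf α n)).2 le_rfl
    · refine fun h' => ?_
      obtain ⟨n, hn, hn'⟩ := (h'.and (hlt α β hαβ)).exists
      exact hn'.not_ge (((hPD n).mem_iff _ (hf α n) _ (hf β n)).1 hn)
  -- A function in `C₀(Ω)` vanishing at no point of any `U n` witnesses that the ideals are proper.
  · obtain ⟨h, hh⟩ := exists_zeroSet_zeroAtInfty (𝕜 := 𝕜) U (fun _ => ∅) hU hUc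
      fun _ => isClosed_empty
    refine ⟨h, fun α h' => ?_⟩
    rw [hh, hclosed _ fun _ => isClosed_empty] at h'
    obtain ⟨n, hn⟩ := h'.exists
    exact ((hPD n).isPrime _).empty_notMem hn
  · exact (hvlim.comp hφ.tendsto_atTop).mono_left h𝒱
  · exact Eventually.mono hZ fun n hn => (hPD n).mem_of_mem _ Z hn

end Chains

/-! ### From prime `z`-filters to prime `z`-ideals of `C₀(Ω)`. -/

section Ideals

variable {𝕜 : Type*} [RCLike 𝕜] {Ω : Type*} [TopologicalSpace Ω]
  [TopologicalSpace.MetrizableSpace Ω] {F : Set (Set Ω)}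

theorem IsPrimeZFilter.isPrimeZIdeal (hF : IsPrimeZFilter 𝕜 F)
    (hne : ∃ h : C₀(Ω, 𝕜), zeroSet h ∉ F) : IsPrimeZIdeal (zInvC₀ 𝕜 F) := by
  have hcl : ∀ f : C₀(Ω, 𝕜), IsClosed (zeroSet f) := fun f =>
    isClosed_eq f.continuous_toFun continuous_const
  have hsub : ∀ f : C₀(Ω, 𝕜), zeroSet f ∈ F → ∀ g : C₀(Ω, 𝕜), zeroSet f ⊆ zeroSet g →
      zeroSet g ∈ F := fun f hf g h => hF.mem_of_subset hf (hcl g) h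
  refine { zero_mem := ?_, add_mem := ?_, smul_mem := ?_, mul_mem := ?_, ne_univ := ?_,
           mem_or_mem := ?_, mem_of_zeroSet_subset := hsub }
  · exact hF.mem_of_subset hF.univ_mem (hcl 0) fun x _ => rfl
  · intro f hf g hg
    refine hF.mem_of_subset (hF.inter_mem _ hf _ hg) (hcl (f + g)) fun x hx => ?_
    have h1 : f x = 0 := hx.1
    have h2 : g x = 0 := hx.2
    simp [zeroSet, h1, h2]
  · intro c f hf
    refine hsub f hf (c • f) fun x hx => ?_
    have h1 : f x = 0 := hx
    simp [zeroSet, h1]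
  · intro g f hf
    refine hsub f hf (g * f) fun x hx => ?_
    have h1 : f x = 0 := hx
    simp [zeroSet, h1]
  · obtain ⟨h, hh⟩ := hne
    exact fun h' => hh (h' ▸ mem_univ h : h ∈ zInvC₀ 𝕜 F)
  · intro f g hfg
    refine hF.mem_or_mem (hcl f) (hcl g) (?_ : zeroSet f ∪ zeroSet g ∈ F)
    have h : zeroSet f ∪ zeroSet g = zeroSet (f * g : C₀(Ω, 𝕜)) := by
      ext x
      simp [zeroSet]
    exact h ▸ hfg

theorem IsPrimeZFilter.supportedAt [LocallyCompactSpace Ω] (hF : IsPrimeZFilter 𝕜 F)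
    {p : OnePoint Ω} {u : ℕ → Ω}
    {𝒱 : Ultrafilter ℕ} (hu : Tendsto (fun n => (u n : OnePoint Ω)) 𝒱 (𝓝 p))
    (h : ∀ Z ∈ F, ∀ᶠ n in (𝒱 : Filter ℕ), u n ∈ Z) :
    ZFilterSupportedAt F p ∧ IdealSupportedAt (zInvC₀ 𝕜 F) p := by
  induction p using OnePoint.rec with
  | coe x =>
    have hlim : Tendsto u 𝒱 (𝓝 x) := by
      rw [← OnePoint.comap_coe_nhds, tendsto_comap_iff]
      exact hu
    have hx : ∀ Z ∈ F, x ∈ Z := fun Z hZ => (hF.isClosed hZ).mem_of_tendsto hlim (h Z hZ)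
    exact ⟨hx, fun f hf => hx _ hf⟩
  | infty =>
    have hlim : Tendsto u 𝒱 (cocompact Ω) := by
      rw [← coclosedCompact_eq_cocompact, ← OnePoint.comap_coe_nhds_infty, tendsto_comap_iff]
      exact hu
    -- As `u` leaves every compact set, no compact `K` is in `F`; by primeness the complement of
    -- `interior K` is, and it is the zero set of a function in `C₀(Ω)` that is nonzero at `x`.
    have key : ∀ x : Ω, ∃ f : C₀(Ω, 𝕜), zeroSet f ∈ F ∧ f x ≠ 0 := by
      intro x
      obtain ⟨K, hK, hxK⟩ := exists_compact_mem_nhds x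
      obtain ⟨f, hf⟩ := exists_zeroSet_zeroAtInfty (𝕜 := 𝕜) (fun _ => interior K) (fun _ => ∅)
        (fun _ => isOpen_interior) (fun _ => ⟨K, hK, interior_subset⟩) fun _ => isClosed_empty
      simp only [empty_union, iInter_const] at hf
      refine ⟨f, ?_, fun h0 => ?_⟩
      · have hKF : K ∉ F := fun hKF => by
          obtain ⟨n, hn, hn'⟩ := ((h K hKF).and (hlim hK.compl_mem_cocompact)).exists
          exact hn' hn
        rw [hf]
        refine (hF.mem_or_mem hK.isClosed isOpen_interior.isClosed_compl ?_).resolve_left hKF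
        rw [eq_univ_of_subset (union_subset_union_left _ interior_subset) (union_compl_self _)]
        exact hF.univ_mem
      · have : x ∈ zeroSet f := h0
        rw [hf] at this
        exact this (mem_interior_iff_mem_nhds.2 hxK)
    refine ⟨?_, ?_⟩ <;> rintro ⟨x, hx⟩ <;> obtain ⟨f, hf, hfx⟩ := key x
    · exact hfx (hx _ hf)
    · exact hfx (hx f hf)

end Ideals

/-- Supplies the binary codes of the indices; the cardinal lifts are needed because the ordinals
below `𝔠` live one universe higher than `ℕ → Bool`. -/
theorem exists_injective_Iio_continuum :
    ∃ r : Set.Iio (Cardinal.continuum.{0}).ord → ℕ → Bool, Function.Injective r := by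
  have h : Cardinal.lift.{0} (Cardinal.mk (Set.Iio (Cardinal.continuum.{0}).ord)) ≤
      Cardinal.lift.{1} (Cardinal.mk (ℕ → Bool)) := by
    simp [Cardinal.mk_Iio_ordinal]
  obtain ⟨r⟩ := Cardinal.lift_mk_le'.1 h
  exact ⟨r, r.injective⟩

theorem theorem4p2 (𝕜 : Type*) [RCLike 𝕜] {Ω : Type*} [TopologicalSpace Ω]
    [TopologicalSpace.MetrizableSpace Ω] [LocallyCompactSpace Ω]
    (p : OnePoint Ω) (hp : p ∈ cbLevelInfty (OnePoint Ω)) :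
    ∃ 𝒬 : Set.Iio (Cardinal.continuum.{0}).ord → Set (Set Ω),
      StrictAnti 𝒬 ∧
      (∀ α, IsPrimeZFilter 𝕜 (𝒬 α) ∧ ZFilterSupportedAt (𝒬 α) p) ∧
      StrictAnti (fun α => zInvC₀ 𝕜 (𝒬 α)) ∧
      (∀ α, IsPrimeZIdeal (zInvC₀ 𝕜 (𝒬 α)) ∧ IdealSupportedAt (zInvC₀ 𝕜 (𝒬 α)) p) := by
  obtain ⟨r, hr⟩ := exists_injective_Iio_continuum
  obtain ⟨𝒬, hanti, hprime, hsep, ⟨g, hg⟩, u, 𝒱, hu, hmem⟩ :=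
    exists_chain_of_mem_cbLevelInfty 𝕜 r hr hp
  refine ⟨𝒬, fun α β hαβ => ?_, fun α => ⟨hprime α, ((hprime α).supportedAt hu (hmem α)).1⟩,
    fun α β hαβ => ?_,
    fun α => ⟨(hprime α).isPrimeZIdeal ⟨g, hg α⟩, ((hprime α).supportedAt hu (hmem α)).2⟩⟩ <;>
  obtain ⟨h, hα, hβ⟩ := hsep α β hαβ
  · exact ⟨hanti hαβ.le, fun h' => hβ (h' hα)⟩
  · exact ⟨fun f hf => hanti hαβ.le hf, fun h' => hβ (h' (show h ∈ zInvC₀ 𝕜 (𝒬 α) from hα))⟩
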